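/- Let $\Phi_0$ be a finite reduced irreducible crystallographic root system in a Euclidean space $(V_0,B_0)$, with Weyl group $W_0$ (whose elements are isometries of $V_0$), simple roots $\Delta_0$, positive roots $\Phi_0^+$ and highest root $\omega$. Let $V=V_0\oplus\mathbb R\delta$, let $B$ be the symmetric bilinear form on $V$ that extends $B_0$ and satisfies $B(\delta,\cdot)=0$, and put $\|v\|=\sqrt{B(v,v)}$. Let $\Delta=\Delta_0\cup\{\delta-\omega\}$ and $$\Phi^+=\{k\delta+\alpha,\ (k+1)\delta-\alpha \mid \alpha\in\Phi_0^+,\ k\in\mathbb N\}$$ be the simple and the positive roots of the associated affine root system; let $S$ be the set of reflections $s_\gamma(v)=v-2\frac{B(v,\gamma)}{B(\gamma,\gamma)}\gamma$ with $\gamma\in\Delta$, let $W$ be the group generated by $S$, and let $\ell$ be its length function with respect to $S$. For $\beta\in\Phi^+$ let $\operatorname{dp}(\beta)=\min\{\ell(w)\mid w\in W,\ w(\beta)\in\Delta\}$. The root poset is $(\Phi^+,\le)$, where $\alpha\le\beta$ if and only if there is $w\in W$ with $w(\alpha)=\beta$ and $\ell(w)=\operatorname{dp}(\beta)-\operatorname{dp}(\alpha)$.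 A covering $\alpha\lhd s_\gamma(\alpha)$ of the root poset, with $\gamma\in\Delta$ and $\alpha\in\Phi^+\setminus\{\gamma\}$, is called short if $-\|\alpha\|\,\|\gamma\|<B(\alpha,\gamma)<0$. Let $\mathcal O\subseteq\Phi_0$ be a $W_0$-orbit and let $\mathcal O^+=\mathcal O\cap\Phi_0^+$. Then the map $\alpha\mapsto\delta-\alpha$ is an isomorphism of posets from $(\mathcal O^+,\le)$ onto the opposite of $(\delta-\mathcal O^+,\le)$: it is a bijection, and for all $\alpha,\beta\in\mathcal O^+$ we have $\alpha\le\beta$ if and only if $\delta-\beta\le\delta-\alpha$. Moreover, every covering relation of the subposet $(\mathcal O^+,\le)$ and every covering relation of the subposet $(\delta-\mathcal O^+,\le)$ is a short covering of the root poset. -/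

import Mathlib

noncomputable section

namespace AffineRoots

/-- The ambient space `V = V₀ ⊕ ℝδ`; a pair `(x, k)` stands for `x + kδ`. -/
abbrev Space (V₀ : Type*) : Type _ := V₀ × ℝ

section Form

variable {V₀ : Type*} [NormedAddCommGroup V₀] [InnerProductSpace ℝ V₀]

/-- The isotropic vector `δ`. -/
def delta : Space V₀ := (0, 1)

/-- The positive semidefinite form `B` on `V`: the scalar product of `V₀` extended by
`B(δ, ·) = 0`. -/
def form : LinearMap.BilinForm ℝ (Space V₀) :=
  (innerₗ V₀).compl₁₂ (LinearMap.fst ℝ V₀ ℝ) (LinearMap.fst ℝ V₀ ℝ)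

theorem form_apply (v w : Space V₀) : form v w = inner ℝ v.1 w.1 := rfl

/-- `‖v‖ = √B(v, v)`. -/
def affNorm (v : Space V₀) : ℝ := Real.sqrt (form v v)

/-- The reflection `s_β : v ↦ v - (2 B(v, β) / B(β, β)) β` in a non-isotropic vector `β`. -/
def refl (β : Space V₀) (hβ : form β β ≠ 0) : Space V₀ ≃ₗ[ℝ] Space V₀ :=
  Module.reflection (x := β) (f := (2 / form β β) • form β)
    (by simp only [LinearMap.smul_apply, smul_eq_mul]; field_simp)

theorem refl_apply (β : Space V₀) (hβ : form β β ≠ 0) (v : Space V₀) :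
    refl β hβ v = v - (2 * form v β / form β β) • β := by
  have h : form β v = form v β := by simp only [form_apply, real_inner_comm]
  rw [refl, Module.reflection_apply, LinearMap.smul_apply, h, smul_eq_mul]
  congr 2
  ring

theorem refl_mul_self (β : Space V₀) (hβ : form β β ≠ 0) : refl β hβ * refl β hβ = 1 := by
  have h : (refl β hβ)⁻¹ = refl β hβ := Module.reflection_inv _
  exact inv_eq_iff_mul_eq_one.mp h

end Form

section Roots

variable {ι V₀ N : Type*} [NormedAddCommGroup V₀] [InnerProductSpace ℝ V₀]
  [AddCommGroup N] [Module ℝ N] {P : RootPairing ι ℝ V₀ N}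

/-- The root `ω` is the highest root with respect to the base `b`: for every root `β`, the
difference `ω - β` is a sum of simple roots. -/
def IsHighest (b : P.Base) (ω : ι) : Prop :=
  ∀ j, P.root ω - P.root j ∈ AddSubmonoid.closure (P.root '' b.support)

/-- The affine simple system `Δ = Δ₀ ∪ {δ - ω}`. -/
def simpleRoots (b : P.Base) (ω : ι) : Set (Space V₀) :=
  {β | ∃ i ∈ b.support, β = (P.root i, 0)} ∪ {delta - (P.root ω, 0)}

/-- The positive affine roots `kδ + α` and `(k + 1)δ - α`, for `α ∈ Φ₀⁺` and `k ∈ ℕ`. -/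
def posRoots (b : P.Base) : Set (Space V₀) :=
  {β | ∃ i, b.IsPos i ∧ ∃ k : ℕ,
    β = (k : ℝ) • delta + (P.root i, 0) ∨ β = ((k : ℝ) + 1) • delta - (P.root i, 0)}

/-- The set `S` of simple reflections `s_β`, `β ∈ Δ`. (Simple roots are never isotropic, see
`form_self_ne_zero`.) -/
def simpleReflections (b : P.Base) (ω : ι) : Set (Space V₀ ≃ₗ[ℝ] Space V₀) :=
  {s | ∃ β ∈ simpleRoots b ω, ∃ hβ : form β β ≠ 0, s = refl β hβ}

theorem form_self_ne_zero (b : P.Base) (ω : ι) {β : Space V₀} (hβ : β ∈ simpleRoots b ω) :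
    form β β ≠ 0 := by
  rcases hβ with ⟨i, -, rfl⟩ | rfl
  · simpa [form_apply] using P.ne_zero i
  · simpa [form_apply, delta] using P.ne_zero ω

/-- The affine Weyl group `W`, generated by `S`. -/
def affineWeyl (b : P.Base) (ω : ι) : Subgroup (Space V₀ ≃ₗ[ℝ] Space V₀) :=
  Subgroup.closure (simpleReflections b ω)

/-- `w = s₁ ⋯ sₙ` for some `s₁, …, sₙ ∈ S`. -/
def HasWord (b : P.Base) (ω : ι) (w : Space V₀ ≃ₗ[ℝ] Space V₀) (n : ℕ) : Prop :=
  ∃ L : List (Space V₀ ≃ₗ[ℝ] Space V₀),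
    L.length = n ∧ (∀ s ∈ L, s ∈ simpleReflections b ω) ∧ L.prod = w

/-- The length function `ℓ` of `(W, S)`. -/
def length (b : P.Base) (ω : ι) (w : Space V₀ ≃ₗ[ℝ] Space V₀) : ℕ :=
  sInf {n | HasWord b ω w n}

/-- The depth `dp(β) = min {ℓ(w) | w ∈ W, w(β) ∈ Δ}`. -/
def depth (b : P.Base) (ω : ι) (β : Space V₀) : ℕ :=
  sInf {n | ∃ w ∈ affineWeyl b ω, w β ∈ simpleRoots b ω ∧ length b ω w = n}

theorem HasWord.mul {b : P.Base} {ω : ι} {u v : Space V₀ ≃ₗ[ℝ] Space V₀} {m n : ℕ}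
    (hu : HasWord b ω u m) (hv : HasWord b ω v n) : HasWord b ω (u * v) (m + n) := by
  obtain ⟨L, rfl, hL, rfl⟩ := hu
  obtain ⟨M, rfl, hM, rfl⟩ := hv
  refine ⟨L ++ M, by simp, ?_, by simp⟩
  intro s hs
  rcases List.mem_append.mp hs with h | h
  exacts [hL s h, hM s h]

theorem inv_eq_of_mem_simpleReflections {b : P.Base} {ω : ι} {s : Space V₀ ≃ₗ[ℝ] Space V₀}
    (hs : s ∈ simpleReflections b ω) : s⁻¹ = s := by
  obtain ⟨β, -, h, rfl⟩ := hs
  exact inv_eq_of_mul_eq_one_left (refl_mul_self β h)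

theorem HasWord.inv {b : P.Base} {ω : ι} {u : Space V₀ ≃ₗ[ℝ] Space V₀} {m : ℕ}
    (hu : HasWord b ω u m) : HasWord b ω u⁻¹ m := by
  obtain ⟨L, rfl, hL, rfl⟩ := hu
  refine ⟨L.reverse, by simp, by simpa using hL, ?_⟩
  rw [List.prod_inv_reverse]
  congr 1
  congr 1
  conv_lhs => rw [← List.map_id L]
  exact List.map_congr_left fun s hs => (inv_eq_of_mem_simpleReflections (hL s hs)).symm

theorem exists_hasWord {b : P.Base} {ω : ι} {w : Space V₀ ≃ₗ[ℝ] Space V₀}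
    (hw : w ∈ affineWeyl b ω) : ∃ n, HasWord b ω w n := by
  induction hw using Subgroup.closure_induction with
  | mem s hs => exact ⟨1, [s], rfl, by simpa using hs, by simp⟩
  | one => exact ⟨0, [], rfl, by simp, rfl⟩
  | mul u v _ _ hu hv =>
    obtain ⟨m, hm⟩ := hu
    obtain ⟨n, hn⟩ := hv
    exact ⟨_, hm.mul hn⟩
  | inv u _ hu =>
    obtain ⟨m, hm⟩ := hu
    exact ⟨m, hm.inv⟩

theorem hasWord_length {b : P.Base} {ω : ι} {w : Space V₀ ≃ₗ[ℝ] Space V₀}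
    (hw : w ∈ affineWeyl b ω) : HasWord b ω w (length b ω w) :=
  Nat.sInf_mem (s := {n | HasWord b ω w n}) (exists_hasWord hw)

theorem length_le {b : P.Base} {ω : ι} {w : Space V₀ ≃ₗ[ℝ] Space V₀} {n : ℕ}
    (h : HasWord b ω w n) : length b ω w ≤ n := Nat.sInf_le h

theorem length_one (b : P.Base) (ω : ι) : length b ω 1 = 0 :=
  Nat.le_zero.mp (length_le ⟨[], rfl, by simp, rfl⟩)

theorem eq_one_of_length {b : P.Base} {ω : ι} {w : Space V₀ ≃ₗ[ℝ] Space V₀}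
    (hw : w ∈ affineWeyl b ω) (h : length b ω w = 0) : w = 1 := by
  obtain ⟨L, hL, -, rfl⟩ := h ▸ hasWord_length hw
  rw [List.length_eq_zero_iff.mp hL, List.prod_nil]

theorem length_mul_le {b : P.Base} {ω : ι} {u v : Space V₀ ≃ₗ[ℝ] Space V₀}
    (hu : u ∈ affineWeyl b ω) (hv : v ∈ affineWeyl b ω) :
    length b ω (u * v) ≤ length b ω u + length b ω v :=
  length_le ((hasWord_length hu).mul (hasWord_length hv))

theorem length_inv_le {b : P.Base} {ω : ι} {u : Space V₀ ≃ₗ[ℝ] Space V₀}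
    (hu : u ∈ affineWeyl b ω) : length b ω u⁻¹ ≤ length b ω u :=
  length_le (hasWord_length hu).inv

/-- Either no element of the orbit of `β` is simple, or depths on the orbit differ by at most the
length of the group element that relates the two vectors. (The first case never occurs for
roots.) -/
theorem depth_apply_le {b : P.Base} {ω : ι} {w : Space V₀ ≃ₗ[ℝ] Space V₀}
    (hw : w ∈ affineWeyl b ω) (β : Space V₀) :
    depth b ω (w β) ≤ depth b ω β + length b ω w := by
  by_cases h : {n | ∃ w ∈ affineWeyl b ω, w β ∈ simpleRoots b ω ∧ length b ω w = n}.Nonempty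
  · obtain ⟨u, hu, huβ, hlen⟩ := Nat.sInf_mem h
    have h1 : depth b ω (w β) ≤ length b ω (u * w⁻¹) :=
      Nat.sInf_le ⟨u * w⁻¹, mul_mem hu (inv_mem hw), by simpa using huβ, rfl⟩
    have h2 := length_mul_le hu (inv_mem hw)
    have h3 := length_inv_le hw
    have h4 : length b ω u = depth b ω β := hlen
    omega
  · have h0 : {n | ∃ u ∈ affineWeyl b ω, u (w β) ∈ simpleRoots b ω ∧ length b ω u = n} = ∅ := by
      rw [Set.eq_empty_iff_forall_notMem]
      rintro n ⟨u, hu, hub, -⟩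
      exact h ⟨_, u * w, mul_mem hu hw, hub, rfl⟩
    have : depth b ω (w β) = 0 := by rw [depth, h0, Nat.sInf_empty]
    omega

/-- The type of positive roots of the affine root system with simple system `Δ₀ ∪ {δ - ω}`. -/
def PosRoot (b : P.Base) (_ω : ι) : Type _ := {β : Space V₀ // β ∈ posRoots b}

/-- The underlying vector of a positive root. -/
def PosRoot.vec {b : P.Base} {ω : ι} (β : PosRoot b ω) : Space V₀ := β.1

/-- The root poset: `α ≤ β` if and only if there is `w ∈ W` with `w(α) = β` and
`ℓ(w) = dp(β) - dp(α)`. -/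
instance (b : P.Base) (ω : ι) : PartialOrder (PosRoot b ω) where
  le α β := ∃ w ∈ affineWeyl b ω, w α.vec = β.vec ∧
    (length b ω w : ℤ) = (depth b ω β.vec : ℤ) - (depth b ω α.vec : ℤ)
  le_refl α := ⟨1, one_mem _, rfl, by simp [length_one]⟩
  le_trans α β γ := by
    rintro ⟨u, hu, huα, hlu⟩ ⟨v, hv, hvβ, hlv⟩
    have e : (v * u) α.vec = γ.vec := by rw [LinearEquiv.mul_apply, huα, hvβ]
    refine ⟨v * u, mul_mem hv hu, e, ?_⟩
    have h1 := length_mul_le hv hu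
    have h2 := depth_apply_le (mul_mem hv hu) α.vec
    rw [e] at h2
    omega
  le_antisymm α β := by
    rintro ⟨u, hu, huα, hlu⟩ ⟨v, hv, hvβ, hlv⟩
    have h : u = 1 := eq_one_of_length hu (by omega)
    subst h
    exact Subtype.ext huα

/-- `α ⋖ β` is a short covering of the root poset: `β = s(α)` for the simple reflection `s` in a
simple root `γ` with `-‖α‖ ‖γ‖ < B(α, γ) < 0`. -/
def IsShortCovering {b : P.Base} {ω : ι} (α β : PosRoot b ω) : Prop :=
  α ⋖ β ∧ ∃ γ ∈ simpleRoots b ω, ∃ hγ : form γ γ ≠ 0, α.vec ≠ γ ∧ refl γ hγ α.vec = β.vec ∧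
    -(affNorm α.vec * affNorm γ) < form α.vec γ ∧ form α.vec γ < 0

/-- `O⁺ = O ∩ Φ₀⁺`, as a set of positive roots of the finite root system. -/
def orbitPos (b : P.Base) (O : Set V₀) : Set V₀ :=
  {x | x ∈ O ∧ ∃ i, b.IsPos i ∧ P.root i = x}

/-- `O⁺` as a set of positive affine roots. -/
def lower (b : P.Base) (ω : ι) (O : Set V₀) : Set (PosRoot b ω) :=
  {β | ∃ x ∈ orbitPos b O, β.vec = (x, 0)}

/-- `δ - O⁺` as a set of positive affine roots. -/
def upper (b : P.Base) (ω : ι) (O : Set V₀) : Set (PosRoot b ω) :=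
  {β | ∃ x ∈ orbitPos b O, β.vec = delta - (x, 0)}

/-- Every vector of `O⁺` is the vector of an element of `lower`. -/
theorem exists_mem_lower (b : P.Base) (ω : ι) (O : Set V₀) {x : V₀} (hx : x ∈ orbitPos b O) :
    ∃ β ∈ lower b ω O, β.vec = (x, 0) := by
  have hx' := hx
  obtain ⟨-, i, hi, rfl⟩ := hx'
  exact ⟨⟨(P.root i, 0), i, hi, 0, Or.inl (by simp)⟩, ⟨_, hx, rfl⟩, rfl⟩

/-- Every vector of `δ - O⁺` is the vector of an element of `upper`. -/
theorem exists_mem_upper (b : P.Base) (ω : ι) (O : Set V₀) {x : V₀} (hx : x ∈ orbitPos b O) :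
    ∃ β ∈ upper b ω O, β.vec = delta - (x, 0) := by
  have hx' := hx
  obtain ⟨-, i, hi, rfl⟩ := hx'
  exact ⟨⟨delta - (P.root i, 0), i, hi, 0, Or.inr (by simp)⟩, ⟨_, hx, rfl⟩, rfl⟩

end Roots

end AffineRoots

end

/-! The order of the root poset is generated by raising steps `v ↦ s_γ(v)`, with `v` a positive
root, `γ` simple and `B(v, γ) < 0` (`posRoot_le_iff`). The key fact is that such a step raises the
depth by exactly one (`depth_refl_lt`, `depth_refl_of_form_neg`). It rests on two properties of the
affine root system: a simple reflection `s_γ` permutes the positive roots other than `γ`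
(`refl_mem_posRoots`), and words in `S` satisfy an exchange property. In particular every step is a
covering.

Call the coefficient of `δ` the level. A step never lowers the level, and a step along `δ - ω`
raises it strictly. A chain between two roots of the same level therefore uses only simple roots of
`Δ₀`. At level zero these are the finite steps `x ↦ s_k(x)` with `(x, α_k) < 0`. Since `s_k(-s_k(x))
= -x` and `(-s_k(x), α_k) = (x, α_k)`, a finite step from `x` to `y` is the same as a step from `δ -
y` to `δ - x`. Hence one relation generates both orders, in opposite directions.

Finite steps stay inside a `W₀`-orbit, so a covering of either subposet is a single step. It is
short: equality in the Cauchy-Schwarz inequality would give `s_k(x) = -x`, but `x` and `s_k(x)` are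
both positive. -/

namespace AffineRoots

/-! ### Finite root system: inner products, heights, the highest root. -/

section FiniteRoots

variable {ι V₀ N : Type*} [NormedAddCommGroup V₀] [InnerProductSpace ℝ V₀]
  [AddCommGroup N] [Module ℝ N] {P : RootPairing ι ℝ V₀ N}

theorem inner_root_self_pos (P : RootPairing ι ℝ V₀ N) (i : ι) :
    0 < inner ℝ (P.root i) (P.root i) :=
  real_inner_self_pos.mpr (P.ne_zero i)

/-- Invariance of the scalar product under `s_i`, tested against `α_i`, identifies the abstract
coroot with `2(x, α_i)/(α_i, α_i)`. -/
theorem two_mul_inner_root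
    (hP : ∀ (i : ι) (x y : V₀), inner ℝ (P.reflection i x) (P.reflection i y) = inner ℝ x y)
    (i : ι) (x : V₀) :
    2 * inner ℝ x (P.root i) = P.coroot' i x * inner ℝ (P.root i) (P.root i) := by
  have h := hP i x (P.root i)
  rw [P.reflection_apply_self, P.reflection_apply, inner_neg_right, inner_sub_left,
    real_inner_smul_left] at h
  linarith

theorem two_mul_inner_root_root
    (hP : ∀ (i : ι) (x y : V₀), inner ℝ (P.reflection i x) (P.reflection i y) = inner ℝ x y)
    (i j : ι) :
    2 * inner ℝ (P.root i) (P.root j) = P.pairing i j * inner ℝ (P.root j) (P.root j) := by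
  rw [two_mul_inner_root hP, P.root_coroot'_eq_pairing]

theorem pairing_neg_iff
    (hP : ∀ (i : ι) (x y : V₀), inner ℝ (P.reflection i x) (P.reflection i y) = inner ℝ x y)
    (i j : ι) : P.pairing i j < 0 ↔ inner ℝ (P.root i) (P.root j) < 0 := by
  have h := two_mul_inner_root_root hP i j
  have h' := inner_root_self_pos P j
  refine ⟨fun hn => ?_, fun hn => ?_⟩
  · linarith [mul_neg_of_neg_of_pos hn h']
  · by_contra! hn'
    linarith [mul_nonneg hn' h'.le]

variable [P.IsRootSystem]

/-- The linear functional that takes the value `1` at every simple root. -/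
noncomputable def heightMap (b : P.Base) : V₀ →ₗ[ℝ] ℝ := b.toWeightBasis.constr ℝ fun _ => 1

theorem heightMap_of_mem_support (b : P.Base) {i : ι} (hi : i ∈ b.support) :
    heightMap b (P.root i) = 1 := by
  have h := b.toWeightBasis.constr_basis ℝ (fun _ => (1 : ℝ)) ⟨i, hi⟩
  rwa [b.toWeightBasis_apply] at h

theorem heightMap_root (b : P.Base) (i : ι) : heightMap b (P.root i) = b.height i := by
  obtain ⟨f, -, -, hf⟩ := b.exists_root_eq_sum_int i
  rw [RootPairing.Base.height_eq_sum hf, hf, map_sum, Int.cast_sum]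
  refine Finset.sum_congr rfl fun j hj => ?_
  rw [map_zsmul, heightMap_of_mem_support b hj, zsmul_eq_mul, mul_one]

theorem heightMap_pos_iff (b : P.Base) (i : ι) : 0 < heightMap b (P.root i) ↔ b.IsPos i := by
  rw [heightMap_root, b.isPos_iff, Int.cast_pos]

theorem heightMap_neg_iff (b : P.Base) (i : ι) : heightMap b (P.root i) < 0 ↔ ¬ b.IsPos i := by
  rw [heightMap_root, b.isPos_iff']
  simp

theorem heightMap_closure (b : P.Base) {v : V₀}
    (hv : v ∈ AddSubmonoid.closure (P.root '' b.support)) : v = 0 ∨ 0 < heightMap b v := by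
  induction hv using AddSubmonoid.closure_induction with
  | mem x hx =>
    obtain ⟨i, hi, rfl⟩ := hx
    exact Or.inr (by rw [heightMap_of_mem_support b hi]; exact one_pos)
  | zero => exact Or.inl rfl
  | add x y _ _ hx hy =>
    rcases hx with rfl | hx
    · simpa using hy
    · rcases hy with rfl | hy
      · simpa using Or.inr hx
      · exact Or.inr (by rw [map_add]; exact add_pos hx hy)

variable {b : P.Base} {ω : ι}

theorem IsHighest.heightMap_lt (hω : IsHighest b ω) {j : ι} (hj : P.root j ≠ P.root ω) :
    heightMap b (P.root j) < heightMap b (P.root ω) := by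
  rcases heightMap_closure b (hω j) with h | h
  · exact absurd (sub_eq_zero.mp h).symm hj
  · rw [map_sub] at h
    linarith

theorem IsHighest.heightMap_le (hω : IsHighest b ω) (j : ι) :
    heightMap b (P.root j) ≤ heightMap b (P.root ω) := by
  by_cases hj : P.root j = P.root ω
  · rw [hj]
  · exact (hω.heightMap_lt hj).le

theorem root_reflectionPerm_self (P : RootPairing ι ℝ V₀ N) (i : ι) :
    P.root (P.reflectionPerm i i) = -P.root i := by
  rw [P.root_reflectionPerm, P.reflection_apply_self]

theorem IsHighest.neg_heightMap_le (hω : IsHighest b ω) (j : ι) :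
    -heightMap b (P.root j) ≤ heightMap b (P.root ω) := by
  simpa [root_reflectionPerm_self] using hω.heightMap_le (P.reflectionPerm j j)

theorem IsHighest.heightMap_pos (hω : IsHighest b ω) : 0 < heightMap b (P.root ω) := by
  by_contra h
  have h1 := hω.neg_heightMap_le ω
  have h2 : heightMap b (P.root ω) ≠ 0 := by
    rw [heightMap_root]
    exact_mod_cast b.height_ne_zero ω
  exact h2 (by linarith)

/-- Otherwise the reflection of `ω` in `α_i` would be a root of greater height. -/
theorem IsHighest.inner_nonneg
    (hP : ∀ (i : ι) (x y : V₀), inner ℝ (P.reflection i x) (P.reflection i y) = inner ℝ x y)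
    (hω : IsHighest b ω) {i : ι} (hi : b.IsPos i) : 0 ≤ inner ℝ (P.root i) (P.root ω) := by
  by_contra! h
  rw [real_inner_comm, ← pairing_neg_iff hP] at h
  have h1 := hω.heightMap_le (P.reflectionPerm i ω)
  rw [P.root_reflectionPerm, P.reflection_apply_root, map_sub, map_smul, smul_eq_mul] at h1
  have h2 := mul_neg_of_neg_of_pos h ((heightMap_pos_iff b i).mpr hi)
  linarith

theorem isPos_of_heightMap_nonneg {i : ι} (h : 0 ≤ heightMap b (P.root i)) : b.IsPos i := by
  by_contra h'
  exact absurd ((heightMap_neg_iff b i).mpr h') (not_lt.mpr h)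

theorem exists_pairing_eq_intCast (P : RootPairing ι ℝ V₀ N) [P.IsCrystallographic] (i j : ι) :
    ∃ m : ℤ, P.pairing i j = m :=
  ⟨P.pairingIn ℤ i j, by rw [← P.algebraMap_pairingIn ℤ]; rfl⟩

end FiniteRoots

/-! ### Affine positive roots and the action of simple reflections. -/

section AffineReflections

variable {ι V₀ N : Type*} [NormedAddCommGroup V₀] [InnerProductSpace ℝ V₀]
  [AddCommGroup N] [Module ℝ N] {P : RootPairing ι ℝ V₀ N} {b : P.Base} {ω : ι}

/-- Writing `(k + 1)δ - α` as the root `-α` at level `k + 1` treats both families alike; positivity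
of the finite part matters only at level zero. -/
theorem mem_posRoots_iff {v : Space V₀} :
    v ∈ posRoots b ↔ ∃ i, ∃ n : ℕ, v = (P.root i, (n : ℝ)) ∧ (n ≠ 0 ∨ b.IsPos i) := by
  constructor
  · rintro ⟨i, hi, k, rfl | rfl⟩
    · exact ⟨i, k, by simp [delta], Or.inr hi⟩
    · refine ⟨P.reflectionPerm i i, k + 1, ?_, Or.inl k.succ_ne_zero⟩
      rw [root_reflectionPerm_self]
      simp [delta]
  · rintro ⟨i, n, rfl, h⟩
    by_cases hi : b.IsPos i
    · exact ⟨i, hi, n, Or.inl (by simp [delta])⟩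
    · have hn : n ≠ 0 := h.resolve_right hi
      obtain ⟨k, rfl⟩ := Nat.exists_eq_succ_of_ne_zero hn
      refine ⟨P.reflectionPerm i i, ?_, k, Or.inr ?_⟩
      · exact (RootPairing.Base.IsPos.or_neg b i).resolve_left hi
      · rw [root_reflectionPerm_self]
        simp [delta]

theorem affNorm_eq (v : Space V₀) : affNorm v = ‖v.1‖ := by
  rw [affNorm, form_apply, real_inner_self_eq_norm_sq, Real.sqrt_sq (norm_nonneg _)]

theorem refl_root
    (hP : ∀ (i : ι) (x y : V₀), inner ℝ (P.reflection i x) (P.reflection i y) = inner ℝ x y)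
    (i : ι) (h : form ((P.root i, 0) : Space V₀) (P.root i, 0) ≠ 0) (x : V₀) (t : ℝ) :
    refl (P.root i, 0) h (x, t) = (P.reflection i x, t) := by
  rw [refl_apply, form_apply, form_apply, two_mul_inner_root hP,
    mul_div_cancel_right₀ _ (inner_root_self_pos P i).ne', P.reflection_apply]
  simp

/-- The finite part of `δ - α` is `-α`, which has the same reflection as `α` but the opposite
pairing; hence the plus sign in the level. -/
theorem refl_delta_sub_root
    (hP : ∀ (i : ι) (x y : V₀), inner ℝ (P.reflection i x) (P.reflection i y) = inner ℝ x y)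
    (i : ι) (h : form (delta - (P.root i, 0) : Space V₀) (delta - (P.root i, 0)) ≠ 0)
    (x : V₀) (t : ℝ) :
    refl (delta - (P.root i, 0)) h (x, t) = (P.reflection i x, t + P.coroot' i x) := by
  have e : (delta - (P.root i, 0) : Space V₀).1 = -P.root i := by simp [delta]
  rw [refl_apply, form_apply, form_apply, e, inner_neg_right, inner_neg_neg, mul_neg,
    two_mul_inner_root hP, neg_div,
    mul_div_cancel_right₀ _ (inner_root_self_pos P i).ne', P.reflection_apply]
  ext <;> simp [delta, sub_eq_add_neg]

theorem refl_self (γ : Space V₀) (h : form γ γ ≠ 0) : refl γ h γ = -γ := by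
  rw [refl_apply, mul_div_cancel_right₀ _ h, two_smul]
  abel

theorem refl_refl (γ : Space V₀) (h : form γ γ ≠ 0) (v : Space V₀) :
    refl γ h (refl γ h v) = v := by
  rw [← LinearEquiv.mul_apply, refl_mul_self, LinearEquiv.coe_one, id]

theorem form_refl_self (γ : Space V₀) (h : form γ γ ≠ 0) (v : Space V₀) :
    form (refl γ h v) γ = -form v γ := by
  rw [refl_apply, map_sub, map_smul, LinearMap.sub_apply, LinearMap.smul_apply, smul_eq_mul,
    div_mul_cancel₀ _ h]
  ring

theorem form_comm (v w : Space V₀) : form v w = form w v := by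
  rw [form_apply, form_apply, real_inner_comm]

theorem form_refl_refl (γ : Space V₀) (h : form γ γ ≠ 0) (v w : Space V₀) :
    form (refl γ h v) (refl γ h w) = form v w := by
  rw [refl_apply γ h w, map_sub, map_smul, form_refl_self, smul_eq_mul, refl_apply, map_sub,
    map_smul, LinearMap.sub_apply, LinearMap.smul_apply, smul_eq_mul, form_comm γ w]
  field_simp
  ring

theorem delta_sub_root_mem_simpleRoots : delta - (P.root ω, 0) ∈ simpleRoots b ω :=
  Or.inr rfl

theorem root_mem_simpleRoots {i : ι} (hi : i ∈ b.support) :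
    ((P.root i, 0) : Space V₀) ∈ simpleRoots b ω :=
  Or.inl ⟨i, hi, rfl⟩

theorem simpleRoots_subset_posRoots : simpleRoots b ω ⊆ posRoots b := by
  rintro _ (⟨i, hi, rfl⟩ | rfl)
  · exact mem_posRoots_iff.mpr
      ⟨i, 0, by simp, Or.inr (RootPairing.Base.isPos_of_mem_support hi)⟩
  · refine mem_posRoots_iff.mpr ⟨P.reflectionPerm ω ω, 1, ?_, Or.inl one_ne_zero⟩
    rw [root_reflectionPerm_self]
    simp [delta]

/-- A positive root has positive product with some simple root. -/
theorem exists_simpleRoot_form_pos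
    (hω : IsHighest b ω) {v : Space V₀} (hv : v ∈ posRoots b) :
    ∃ γ ∈ simpleRoots b ω, 0 < form v γ := by
  obtain ⟨i, n, rfl, hi⟩ := mem_posRoots_iff.mp hv
  by_contra! H
  have hb : ∀ j ∈ b.support, inner ℝ (P.root i) (P.root j) ≤ 0 := fun j hj =>
    H _ (root_mem_simpleRoots hj)
  have h0 : 0 ≤ inner ℝ (P.root i) (P.root ω) := by
    have := H _ delta_sub_root_mem_simpleRoots
    rw [form_apply] at this
    simpa [delta, inner_neg_right] using this
  have hcl : ∀ y ∈ AddSubmonoid.closure (P.root '' b.support), inner ℝ (P.root i) y ≤ 0 := by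
    intro y hy
    induction hy using AddSubmonoid.closure_induction with
    | mem x hx =>
      obtain ⟨j, hj, rfl⟩ := hx
      exact hb j hj
    | zero => simp
    | add x y _ _ hx hy =>
      rw [inner_add_right]
      exact add_nonpos hx hy
  -- Highestness is applied to the root `-α_i`: `ω + α_i` is a sum of simple roots, so its product
  -- with `α_i` is at most zero, although `(α_i, ω) ≥ 0` and `(α_i, α_i) > 0`.
  have h1 := hcl _ (hω (P.reflectionPerm i i))
  rw [root_reflectionPerm_self, inner_sub_right, inner_neg_right] at h1
  linarith [inner_root_self_pos P i]

theorem exists_two_mul_form_div_eq [P.IsCrystallographic]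
    (hP : ∀ (i : ι) (x y : V₀), inner ℝ (P.reflection i x) (P.reflection i y) = inner ℝ x y)
    {γ v : Space V₀} (hγ : γ ∈ simpleRoots b ω) (hv : v ∈ posRoots b) :
    ∃ m : ℤ, 2 * form v γ / form γ γ = m := by
  obtain ⟨i, n, rfl, -⟩ := mem_posRoots_iff.mp hv
  obtain ⟨j, t, ht⟩ : ∃ (j : ι) (t : ℝ), γ = (P.root j, t) := by
    obtain ⟨j, n, rfl, -⟩ := mem_posRoots_iff.mp (simpleRoots_subset_posRoots hγ)
    exact ⟨j, n, rfl⟩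
  obtain ⟨m, hm⟩ := exists_pairing_eq_intCast P i j
  refine ⟨m, ?_⟩
  rw [ht, form_apply, form_apply, two_mul_inner_root_root hP, hm,
    mul_div_cancel_right₀ _ (inner_root_self_pos P j).ne']

variable [P.IsRootSystem]

/-- The linear functional that takes the value `1` at every affine simple root. -/
noncomputable def affHeight (b : P.Base) (ω : ι) : Space V₀ →ₗ[ℝ] ℝ :=
  (heightMap b).coprod ((1 + heightMap b (P.root ω)) • LinearMap.id)

theorem affHeight_apply (x : V₀) (t : ℝ) :
    affHeight b ω (x, t) = heightMap b x + (1 + heightMap b (P.root ω)) * t := by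
  simp [affHeight]

theorem affHeight_of_mem_simpleRoots {γ : Space V₀} (hγ : γ ∈ simpleRoots b ω) :
    affHeight b ω γ = 1 := by
  rcases hγ with ⟨i, hi, rfl⟩ | rfl
  · rw [affHeight_apply, heightMap_of_mem_support b hi, mul_zero, add_zero]
  · rw [map_sub, delta, affHeight_apply, affHeight_apply, map_zero]
    ring

/-- The weight `1 + ht(ω)` of one level outweighs any negative finite part, so this height separates
positive from negative roots. -/
theorem affHeight_pos (hω : IsHighest b ω) {v : Space V₀} (hv : v ∈ posRoots b) :
    0 < affHeight b ω v := by
  obtain ⟨i, n, rfl, h⟩ := mem_posRoots_iff.mp hv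
  have h0 := hω.heightMap_pos
  have h1 := hω.neg_heightMap_le i
  rw [affHeight_apply]
  by_cases hn : n = 0
  · subst hn
    simpa using (heightMap_pos_iff b i).mpr (h.resolve_left (not_not_intro rfl))
  · have hn1 : (1 : ℝ) ≤ n := by exact_mod_cast Nat.one_le_iff_ne_zero.mpr hn
    nlinarith

variable [Finite ι] [P.IsCrystallographic] [P.IsReduced]

/-- A simple reflection permutes the positive roots other than its own root. -/
theorem refl_mem_posRoots
    (hP : ∀ (i : ι) (x y : V₀), inner ℝ (P.reflection i x) (P.reflection i y) = inner ℝ x y)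
    (hω : IsHighest b ω) {γ v : Space V₀} (hγ : γ ∈ simpleRoots b ω) (h : form γ γ ≠ 0)
    (hv : v ∈ posRoots b) (hne : v ≠ γ) : refl γ h v ∈ posRoots b := by
  obtain ⟨i, n, rfl, hi⟩ := mem_posRoots_iff.mp hv
  rw [mem_posRoots_iff]
  rcases hγ with ⟨j, hj, rfl⟩ | rfl
  · rw [refl_root hP, ← P.root_reflectionPerm]
    refine ⟨_, n, rfl, or_iff_not_imp_left.mpr fun hn => ?_⟩
    rw [not_not] at hn
    subst hn
    refine (hi.resolve_left (not_not_intro rfl)).reflectionPerm hj ?_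
    rintro rfl
    exact hne (by simp)
  · obtain ⟨m, hm⟩ := exists_pairing_eq_intCast P i ω
    rw [refl_delta_sub_root hP, P.root_coroot'_eq_pairing, ← P.root_reflectionPerm, hm]
    have hr : heightMap b (P.root (P.reflectionPerm ω i))
        = heightMap b (P.root i) - m * heightMap b (P.root ω) := by
      rw [P.root_reflectionPerm, P.reflection_apply_root, map_sub, map_smul, hm, smul_eq_mul]
    have hω0 := hω.heightMap_pos
    have of_le : ∀ k : ℕ, (n : ℤ) + m = k → (k ≠ 0 ∨ b.IsPos (P.reflectionPerm ω i)) →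
        ∃ j, ∃ k : ℕ, ((P.root (P.reflectionPerm ω i), (n : ℝ) + m) : Space V₀)
          = (P.root j, (k : ℝ)) ∧ (k ≠ 0 ∨ b.IsPos j) := by
      intro k hk hk'
      refine ⟨_, k, ?_, hk'⟩
      rw [show (n : ℝ) + m = k by exact_mod_cast hk]
    -- The reflection adds `m` to the level. Only `m < 0` is delicate; there `α_i` is negative
    -- because `ω` is dominant, so `n ≥ 1`.
    rcases lt_trichotomy m 0 with hm0 | rfl | hm0
    · have hneg : ¬ b.IsPos i := by
        intro hpos
        have h1 := hω.inner_nonneg hP hpos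
        have h2 : P.pairing i ω < 0 := by rw [hm]; exact_mod_cast hm0
        exact absurd ((pairing_neg_iff hP i ω).mp h2) (not_lt.mpr h1)
      have hn : 1 ≤ n := Nat.one_le_iff_ne_zero.mpr (hi.resolve_right hneg)
      have h1 := hω.neg_heightMap_le i
      by_cases hm1 : m = -1
      · subst hm1
        refine of_le (n - 1) (by omega) (Or.inr (isPos_of_heightMap_nonneg ?_))
        rw [hr]
        push_cast
        linarith
      -- Here `s_ω(α_i) = α_i - mω` would be too high unless `α_i = -ω`. Then `m = -2`, and `n = 1`
      -- is excluded because it would give `δ - ω` itself.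
      · have hm2 : (m : ℝ) ≤ -2 := by
          have : m ≤ -2 := by omega
          exact_mod_cast this
        have h2 := hω.heightMap_le (P.reflectionPerm ω i)
        rw [hr] at h2
        have h3 : P.root i = -P.root ω := by
          by_contra hc
          have := hω.heightMap_lt (j := P.reflectionPerm i i)
            (by rw [root_reflectionPerm_self]; exact fun e => hc (by rw [← e, neg_neg]))
          rw [root_reflectionPerm_self, map_neg] at this
          nlinarith
        have h4 : m = -2 := by
          have h6 := two_mul_inner_root_root hP i ω
          rw [h3, inner_neg_left, hm] at h6
          have h7 := inner_root_self_pos P ω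
          have h8 : (m : ℝ) = -2 := by
            apply mul_right_cancel₀ h7.ne'
            linarith
          exact_mod_cast h8
        subst h4
        have hn2 : n ≠ 1 := by
          rintro rfl
          exact hne (by rw [h3]; simp [delta])
        refine of_le (n - 2) (by omega) (Or.inr (isPos_of_heightMap_nonneg ?_))
        rw [hr, h3, map_neg]
        push_cast
        linarith
    · refine of_le n (by omega) (hi.imp_right fun hp => isPos_of_heightMap_nonneg ?_)
      rw [hr]
      simpa using ((heightMap_pos_iff b i).mpr hp).le
    · exact of_le (n + m.toNat) (by omega) (Or.inl (by omega))

end AffineReflections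

/-! ### Depth, the exchange property, and generation of the order by steps. -/

section Depth

variable {ι V₀ N : Type*} [NormedAddCommGroup V₀] [InnerProductSpace ℝ V₀]
  [AddCommGroup N] [Module ℝ N] {P : RootPairing ι ℝ V₀ N} {b : P.Base} {ω : ι}

theorem refl_mem_simpleReflections {γ : Space V₀} (hγ : γ ∈ simpleRoots b ω)
    (h : form γ γ ≠ 0) : refl γ h ∈ simpleReflections b ω := ⟨γ, hγ, h, rfl⟩

theorem list_prod_mem_affineWeyl {L : List (Space V₀ ≃ₗ[ℝ] Space V₀)}
    (hL : ∀ s ∈ L, s ∈ simpleReflections b ω) : L.prod ∈ affineWeyl b ω :=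
  Subgroup.list_prod_mem _ fun s hs => Subgroup.subset_closure (hL s hs)

theorem length_list_prod_le {L : List (Space V₀ ≃ₗ[ℝ] Space V₀)}
    (hL : ∀ s ∈ L, s ∈ simpleReflections b ω) : length b ω L.prod ≤ L.length :=
  length_le ⟨L, rfl, hL, rfl⟩

theorem length_refl_le {γ : Space V₀} (hγ : γ ∈ simpleRoots b ω) (h : form γ γ ≠ 0) :
    length b ω (refl γ h) ≤ 1 :=
  length_le ⟨[refl γ h], rfl, by simpa using refl_mem_simpleReflections hγ h, by simp⟩

theorem depth_le {w : Space V₀ ≃ₗ[ℝ] Space V₀} (hw : w ∈ affineWeyl b ω) {v : Space V₀}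
    (hv : w v ∈ simpleRoots b ω) : depth b ω v ≤ length b ω w :=
  Nat.sInf_le ⟨w, hw, hv, rfl⟩

theorem depth_eq_zero {γ : Space V₀} (hγ : γ ∈ simpleRoots b ω) : depth b ω γ = 0 :=
  Nat.le_zero.mp (length_one b ω ▸ depth_le (one_mem _) hγ)

theorem depth_refl_le {γ : Space V₀} (hγ : γ ∈ simpleRoots b ω) (h : form γ γ ≠ 0)
    (v : Space V₀) : depth b ω (refl γ h v) ≤ depth b ω v + 1 :=
  (depth_apply_le (Subgroup.subset_closure (refl_mem_simpleReflections hγ h)) v).trans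
    (Nat.add_le_add_left (length_refl_le hγ h) _)

theorem form_list_prod {L : List (Space V₀ ≃ₗ[ℝ] Space V₀)}
    (hL : ∀ s ∈ L, s ∈ simpleReflections b ω) (v w : Space V₀) :
    form (L.prod v) (L.prod w) = form v w := by
  induction L with
  | nil => simp
  | cons s L ih =>
    obtain ⟨γ, -, h, rfl⟩ := hL s (by simp)
    rw [List.prod_cons, LinearEquiv.mul_apply, LinearEquiv.mul_apply, form_refl_refl,
      ih fun s hs => hL s (by simp [hs])]

/-- `v` is a positive or a negative root. -/
def IsRoot (b : P.Base) (v : Space V₀) : Prop := v ∈ posRoots b ∨ -v ∈ posRoots b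

theorem ne_of_form_neg {v γ : Space V₀} (h : form v γ < 0) : v ≠ γ := by
  rintro rfl
  exact absurd h (not_lt.mpr real_inner_self_nonneg)

theorem depth_lt_of_lt {α β : PosRoot b ω} (h : α < β) :
    depth b ω α.vec < depth b ω β.vec := by
  obtain ⟨w, hw, hwα, hlen⟩ := h.le
  by_contra! hd
  have hw1 : w = 1 := eq_one_of_length hw (by omega)
  subst hw1
  exact h.ne (Subtype.ext hwα)

variable [P.IsRootSystem]

theorem neg_notMem_posRoots (hω : IsHighest b ω) {v : Space V₀} (hv : v ∈ posRoots b) :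
    -v ∉ posRoots b := by
  intro h
  have h1 := affHeight_pos hω hv
  have h2 := affHeight_pos hω h
  rw [map_neg] at h2
  linarith

theorem IsRoot.neg_mem_of_affHeight_neg (hω : IsHighest b ω) {v : Space V₀} (hv : IsRoot b v)
    (h : affHeight b ω v < 0) : -v ∈ posRoots b :=
  hv.resolve_left fun h' => absurd (affHeight_pos hω h') (not_lt.mpr h.le)

variable [Finite ι] [P.IsCrystallographic] [P.IsReduced]

theorem IsRoot.refl
    (hP : ∀ (i : ι) (x y : V₀), inner ℝ (P.reflection i x) (P.reflection i y) = inner ℝ x y)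
    (hω : IsHighest b ω) {γ v : Space V₀} (hγ : γ ∈ simpleRoots b ω) (h : form γ γ ≠ 0)
    (hv : IsRoot b v) : IsRoot b (refl γ h v) := by
  rcases hv with hv | hv
  · by_cases e : v = γ
    · right
      rw [e, refl_self, neg_neg]
      exact simpleRoots_subset_posRoots hγ
    · exact Or.inl (refl_mem_posRoots hP hω hγ h hv e)
  · by_cases e : -v = γ
    · left
      rw [← neg_neg v, map_neg, e, refl_self, neg_neg]
      exact simpleRoots_subset_posRoots hγ
    · right
      rw [← map_neg]
      exact refl_mem_posRoots hP hω hγ h hv e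

theorem IsRoot.list_prod
    (hP : ∀ (i : ι) (x y : V₀), inner ℝ (P.reflection i x) (P.reflection i y) = inner ℝ x y)
    (hω : IsHighest b ω) {v : Space V₀} (hv : IsRoot b v)
    {L : List (Space V₀ ≃ₗ[ℝ] Space V₀)} (hL : ∀ s ∈ L, s ∈ simpleReflections b ω) :
    IsRoot b (L.prod v) := by
  induction L with
  | nil => simpa using hv
  | cons s L ih =>
    obtain ⟨γ, hγ, h, rfl⟩ := hL s (by simp)
    rw [List.prod_cons, LinearEquiv.mul_apply]
    exact (ih fun s hs => hL s (by simp [hs])).refl hP hω hγ h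

/-- Applied at the letter of a word where a root changes sign. -/
theorem eq_of_neg_refl_mem
    (hP : ∀ (i : ι) (x y : V₀), inner ℝ (P.reflection i x) (P.reflection i y) = inner ℝ x y)
    (hω : IsHighest b ω) {γ v : Space V₀} (hγ : γ ∈ simpleRoots b ω) (h : form γ γ ≠ 0)
    (hv : v ∈ posRoots b) (hn : -refl γ h v ∈ posRoots b) : v = γ := by
  by_contra e
  exact neg_notMem_posRoots hω (refl_mem_posRoots hP hω hγ h hv e) hn

/-- Ensures that the depth of a positive root is a true minimum and not the default value `sInf ∅ =
0`. -/
theorem exists_apply_mem_simpleRoots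
    (hP : ∀ (i : ι) (x y : V₀), inner ℝ (P.reflection i x) (P.reflection i y) = inner ℝ x y)
    (hω : IsHighest b ω) {v : Space V₀} (hv : v ∈ posRoots b) :
    ∃ w ∈ affineWeyl b ω, w v ∈ simpleRoots b ω := by
  -- Induction on the height: reflection in a simple `γ ≠ v` with `B(v, γ) > 0` subtracts a positive
  -- integer multiple of `γ`, so the height drops by at least one and stays positive.
  suffices ∀ (n : ℕ) (v : Space V₀), v ∈ posRoots b → affHeight b ω v ≤ n →
      ∃ w ∈ affineWeyl b ω, w v ∈ simpleRoots b ω from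
    this ⌈affHeight b ω v⌉₊ v hv (Nat.le_ceil _)
  intro n
  induction n with
  | zero =>
    intro v hv h
    exact absurd (affHeight_pos hω hv) (not_lt.mpr (by simpa using h))
  | succ n ih =>
    intro v hv hn
    obtain ⟨γ, hγ, hpos⟩ := exists_simpleRoot_form_pos hω hv
    by_cases e : v = γ
    · exact ⟨1, one_mem _, by simpa [e] using hγ⟩
    · have h := form_self_ne_zero b ω hγ
      obtain ⟨m, hm⟩ := exists_two_mul_form_div_eq hP hγ hv
      have hγγ : 0 < form γ γ := lt_of_le_of_ne real_inner_self_nonneg h.symm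
      have hm0 : (0 : ℝ) < m := by
        rw [← hm]
        positivity
      have hm1 : (1 : ℝ) ≤ m := by
        have : 0 < m := by exact_mod_cast hm0
        exact_mod_cast this
      obtain ⟨w, hw, hwv⟩ := ih (refl γ h v) (refl_mem_posRoots hP hω hγ h hv e) (by
        rw [refl_apply, map_sub, map_smul, affHeight_of_mem_simpleRoots hγ, hm, smul_eq_mul]
        push_cast at hn
        linarith)
      exact ⟨w * refl γ h,
        mul_mem hw (Subgroup.subset_closure (refl_mem_simpleReflections hγ h)), hwv⟩

theorem exists_length_eq_depth
    (hP : ∀ (i : ι) (x y : V₀), inner ℝ (P.reflection i x) (P.reflection i y) = inner ℝ x y)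
    (hω : IsHighest b ω) {v : Space V₀} (hv : v ∈ posRoots b) :
    ∃ w ∈ affineWeyl b ω, w v ∈ simpleRoots b ω ∧ length b ω w = depth b ω v := by
  obtain ⟨w, hw, hwv⟩ := exists_apply_mem_simpleRoots hP hω hv
  exact Nat.sInf_mem (s := {n | ∃ w ∈ affineWeyl b ω, w v ∈ simpleRoots b ω ∧ length b ω w = n})
    ⟨_, w, hw, hwv, rfl⟩

/-- A word that makes the positive root `v` negative is longer than the depth of `v`. -/
theorem depth_lt_of_neg_list_prod_mem
    (hP : ∀ (i : ι) (x y : V₀), inner ℝ (P.reflection i x) (P.reflection i y) = inner ℝ x y)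
    (hω : IsHighest b ω) {v : Space V₀} (hv : v ∈ posRoots b)
    {L : List (Space V₀ ≃ₗ[ℝ] Space V₀)} (hL : ∀ s ∈ L, s ∈ simpleReflections b ω)
    (hn : -L.prod v ∈ posRoots b) : depth b ω v < L.length := by
  induction L with
  | nil => exact absurd hn (neg_notMem_posRoots hω hv)
  | cons s L ih =>
    have hL' : ∀ s ∈ L, s ∈ simpleReflections b ω := fun s hs => hL s (by simp [hs])
    obtain ⟨γ, hγ, h, rfl⟩ := hL s (by simp)
    rw [List.length_cons, Nat.lt_succ_iff]
    -- If the tail keeps `v` positive, the first letter changes the sign, so the tail has carried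
    -- `v` to the simple root `γ`.
    rcases IsRoot.list_prod hP hω (Or.inl hv) hL' with hy | hy
    · have e := eq_of_neg_refl_mem hP hω hγ h hy hn
      exact (depth_le (list_prod_mem_affineWeyl hL') (e ▸ hγ)).trans (length_list_prod_le hL')
    · exact (ih hL' hy).le

/-- The exchange property: a word that makes the simple root `γ` negative can be shortened by one
letter after multiplication by the reflection in `γ`. -/
theorem exists_list_prod_mul_refl
    (hP : ∀ (i : ι) (x y : V₀), inner ℝ (P.reflection i x) (P.reflection i y) = inner ℝ x y)
    (hω : IsHighest b ω) {γ : Space V₀} (hγ : γ ∈ simpleRoots b ω) (h : form γ γ ≠ 0)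
    {L : List (Space V₀ ≃ₗ[ℝ] Space V₀)} (hL : ∀ s ∈ L, s ∈ simpleReflections b ω)
    (hn : -L.prod γ ∈ posRoots b) :
    ∃ M : List (Space V₀ ≃ₗ[ℝ] Space V₀), M.length + 1 = L.length ∧
      (∀ s ∈ M, s ∈ simpleReflections b ω) ∧ M.prod = L.prod * refl γ h := by
  induction L with
  | nil => exact absurd hn (neg_notMem_posRoots hω (simpleRoots_subset_posRoots hγ))
  | cons s L ih =>
    have hL' : ∀ s ∈ L, s ∈ simpleReflections b ω := fun s hs => hL s (by simp [hs])
    have hs := hL s (by simp)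
    rcases IsRoot.list_prod hP hω (Or.inl (simpleRoots_subset_posRoots hγ)) hL' with hy | hy
    · obtain ⟨η, hη, h', rfl⟩ := hs
      have e := eq_of_neg_refl_mem hP hω hη h' hy hn
      -- The tail carries `γ` to `η` and preserves the form, so `s_η L = L s_γ` and the letter `s_η`
      -- cancels.
      refine ⟨L, by simp, hL', ?_⟩
      ext1 v
      rw [List.prod_cons, LinearEquiv.mul_apply, LinearEquiv.mul_apply, refl_apply η, refl_apply γ,
        map_sub, map_smul, map_sub, map_smul, ← e, LinearMap.sub_apply, LinearMap.smul_apply,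
        form_list_prod hL', form_list_prod hL', smul_eq_mul, div_mul_cancel₀ _ h, sub_sub,
        ← add_smul]
      rw [show 2 * form v γ / form γ γ + 2 * (form v γ - 2 * form v γ) / form γ γ = 0 by ring,
        zero_smul, sub_zero]
    · obtain ⟨M, hM, hMs, hMp⟩ := ih hL' hy
      refine ⟨s :: M, by simp [hM], ?_, by rw [List.prod_cons, hMp, List.prod_cons, mul_assoc]⟩
      simpa using ⟨hs, hMs⟩

/-- A simple reflection that lowers a positive root lowers its depth. -/
theorem depth_refl_lt
    (hP : ∀ (i : ι) (x y : V₀), inner ℝ (P.reflection i x) (P.reflection i y) = inner ℝ x y)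
    (hω : IsHighest b ω) {γ v : Space V₀} (hγ : γ ∈ simpleRoots b ω) (h : form γ γ ≠ 0)
    (hv : v ∈ posRoots b) (hne : v ≠ γ) (hpos : 0 < form v γ) :
    depth b ω (refl γ h v) < depth b ω v := by
  obtain ⟨w, hw, hwv, hlen⟩ := exists_length_eq_depth hP hω hv
  obtain ⟨L, hLn, hL, hLw⟩ := hasWord_length hw
  have hγp := simpleRoots_subset_posRoots hγ
  have hLroot : IsRoot b (w γ) := hLw ▸ IsRoot.list_prod hP hω (Or.inl hγp) hL
  have hvr := refl_mem_posRoots hP hω hγ h hv hne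
  rw [← hlen, ← hLn]
  -- With `w` a shortest element carrying `v` to a simple root `η`: if `w(γ)` is positive, `w` is
  -- shown to make `s_γ(v)` negative; if `w(γ)` is negative, exchange shortens `w s_γ`, which
  -- carries `s_γ(v)` to `η`.
  rcases hLroot with hwγ | hwγ
  · set η := w v with hη
    have hηη := form_self_ne_zero b ω hwv
    have hγγ : 0 < form γ γ := lt_of_le_of_ne real_inner_self_nonneg h.symm
    have hcons : ∀ s ∈ refl η hηη :: L, s ∈ simpleReflections b ω := by
      simpa using ⟨refl_mem_simpleReflections hwv hηη, hL⟩
    have hne' : w γ ≠ η := fun e => hne (w.injective e).symm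
    have h1 := affHeight_pos hω (refl_mem_posRoots hP hω hwv hηη hwγ hne')
    have h2 : 0 < 2 * form v γ / form γ γ := by positivity
    have h3 : w (refl γ h v) = η - (2 * form v γ / form γ γ) • w γ := by
      rw [refl_apply, map_sub, map_smul]
    have h4 : IsRoot b (refl η hηη (w (refl γ h v))) := by
      have := IsRoot.list_prod hP hω (Or.inl hvr) hcons
      rwa [List.prod_cons, hLw] at this
    -- With `c = 2B(v, γ)/B(γ, γ) > 0`, the root `s_η w s_γ(v)` equals `-η - c s_η(w(γ))`, where
    -- `s_η(w(γ))` is positive. Its negative is not `η`, so applying `s_η` again leaves the sign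
    -- unchanged.
    have h5 : -refl η hηη (w (refl γ h v)) ∈ posRoots b := by
      refine h4.neg_mem_of_affHeight_neg hω ?_
      rw [h3, map_sub, map_smul, refl_self, map_sub, map_neg, map_smul, smul_eq_mul,
        affHeight_of_mem_simpleRoots hwv]
      linarith [mul_pos h2 h1]
    refine depth_lt_of_neg_list_prod_mem hP hω hvr hL ?_
    rw [hLw]
    have h6 : -refl η hηη (w (refl γ h v)) ≠ η := by
      intro e
      have h7 : w (refl γ h v) = η := by
        have e' := congrArg (refl η hηη) e
        rwa [map_neg, refl_refl, refl_self, neg_inj] at e'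
      rw [h3, sub_eq_self, smul_eq_zero] at h7
      rcases h7 with h7 | h7
      · exact h2.ne' h7
      · have := affHeight_pos hω hwγ
        rw [h7, map_zero] at this
        exact this.false
    have h7 := refl_mem_posRoots hP hω hwv hηη h5 h6
    rwa [map_neg, refl_refl] at h7
  · obtain ⟨M, hMlen, hM, hMp⟩ := exists_list_prod_mul_refl hP hω hγ h hL (by rwa [hLw])
    rw [← hMlen, Nat.lt_succ_iff]
    refine (depth_le (list_prod_mem_affineWeyl hM) ?_).trans (length_list_prod_le hM)
    rw [hMp, LinearEquiv.mul_apply, refl_refl, hLw]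
    exact hwv

/-- The root `s_γ(v)` has positive product with `γ`, so returning to `v` lowers the depth; a simple
reflection raises it by at most one. -/
theorem depth_refl_of_form_neg
    (hP : ∀ (i : ι) (x y : V₀), inner ℝ (P.reflection i x) (P.reflection i y) = inner ℝ x y)
    (hω : IsHighest b ω) {γ v : Space V₀} (hγ : γ ∈ simpleRoots b ω) (h : form γ γ ≠ 0)
    (hv : v ∈ posRoots b) (hne : v ≠ γ) (hneg : form v γ < 0) :
    depth b ω (refl γ h v) = depth b ω v + 1 := by
  have hne' : refl γ h v ≠ γ := by
    intro e
    have e' : v = -γ := by rw [← refl_refl γ h v, e, refl_self]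
    exact neg_notMem_posRoots hω (simpleRoots_subset_posRoots hγ) (e' ▸ hv)
  have h1 := depth_refl_lt hP hω hγ h (refl_mem_posRoots hP hω hγ h hv hne) hne'
    (by rw [form_refl_self]; linarith)
  rw [refl_refl] at h1
  have h2 := depth_refl_le hγ h v
  omega

/-- `v` is a positive root, and `u = s_γ(v)` for a simple root `γ` with `B(v, γ) < 0`. -/
def IsStep (b : P.Base) (ω : ι) (v u : Space V₀) : Prop :=
  v ∈ posRoots b ∧ ∃ γ ∈ simpleRoots b ω, ∃ h : form γ γ ≠ 0, form v γ < 0 ∧ u = refl γ h v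

/-- The total gain in depth equals the number of letters, so each letter must raise the depth by
one, which leaves only raising steps. -/
theorem reflTransGen_isStep_of_depth_eq
    (hP : ∀ (i : ι) (x y : V₀), inner ℝ (P.reflection i x) (P.reflection i y) = inner ℝ x y)
    (hω : IsHighest b ω) {v : Space V₀} (hv : v ∈ posRoots b)
    {L : List (Space V₀ ≃ₗ[ℝ] Space V₀)} (hL : ∀ s ∈ L, s ∈ simpleReflections b ω)
    (hu : L.prod v ∈ posRoots b) (hd : depth b ω (L.prod v) = depth b ω v + L.length) :
    Relation.ReflTransGen (IsStep b ω) v (L.prod v) := by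
  induction L with
  | nil => exact Relation.ReflTransGen.refl
  | cons s L ih =>
    have hL' : ∀ s ∈ L, s ∈ simpleReflections b ω := fun s hs => hL s (by simp [hs])
    obtain ⟨γ, hγ, h, rfl⟩ := hL s (by simp)
    rw [List.prod_cons, LinearEquiv.mul_apply] at hu hd ⊢
    rw [List.length_cons] at hd
    have h1 := depth_refl_le hγ h (L.prod v)
    have h2 := depth_apply_le (list_prod_mem_affineWeyl hL') v
    have h3 := length_list_prod_le hL'
    rcases IsRoot.list_prod hP hω (Or.inl hv) hL' with hy | hy
    · refine (ih hL' hy (by omega)).tail ⟨hy, γ, hγ, h, ?_, rfl⟩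
      by_contra! hn
      rcases hn.eq_or_lt with hn | hn
      · rw [refl_apply, ← hn, mul_zero, zero_div, zero_smul, sub_zero] at hd
        omega
      · have hne : L.prod v ≠ γ := by
          intro e
          rw [e, refl_self] at hu
          exact neg_notMem_posRoots hω (simpleRoots_subset_posRoots hγ) hu
        have := depth_refl_lt hP hω hγ h hy hne hn
        omega
    -- A return from negative to positive could only end at `γ` itself, whose depth is zero.
    · have e := eq_of_neg_refl_mem hP hω hγ h hy (by rwa [map_neg, neg_neg])
      rw [← neg_neg (L.prod v), e, map_neg, refl_self, neg_neg, depth_eq_zero hγ] at hd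
      omega

/-- The order of the root poset is generated by the raising simple reflections. -/
theorem posRoot_le_iff
    (hP : ∀ (i : ι) (x y : V₀), inner ℝ (P.reflection i x) (P.reflection i y) = inner ℝ x y)
    (hω : IsHighest b ω) {α β : PosRoot b ω} :
    α ≤ β ↔ Relation.ReflTransGen (IsStep b ω) α.vec β.vec := by
  constructor
  · rintro ⟨w, hw, hwα, hlen⟩
    obtain ⟨L, hLn, hL, hLw⟩ := hasWord_length hw
    have := reflTransGen_isStep_of_depth_eq hP hω α.2 hL
      (by rw [hLw]; exact hwα ▸ β.2)
      (by
        have : L.prod α.1 = β.vec := by rw [hLw]; exact hwα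
        rw [this, hLn]
        have e : depth b ω α.1 = depth b ω α.vec := rfl
        omega)
    rw [hLw] at this
    exact hwα ▸ this
  · intro h
    suffices ∀ u, Relation.ReflTransGen (IsStep b ω) α.vec u →
        ∀ β : PosRoot b ω, β.vec = u → α ≤ β from this _ h β rfl
    intro u hu
    induction hu with
    | refl => exact fun β hβ => (Subtype.ext hβ : β = α) ▸ le_rfl
    | @tail y u _ hs ih =>
      intro β hβ
      obtain ⟨hy, γ, hγ, h', hn, rfl⟩ := hs
      refine le_trans (ih ⟨y, hy⟩ rfl) ⟨refl γ h',
        Subgroup.subset_closure (refl_mem_simpleReflections hγ h'), hβ.symm, ?_⟩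
      have h1 := depth_refl_of_form_neg hP hω hγ h' hy (ne_of_form_neg hn) hn
      have h2 := length_refl_le hγ h'
      have h3 := depth_apply_le (b := b) (ω := ω)
        (Subgroup.subset_closure (refl_mem_simpleReflections hγ h')) y
      rw [hβ]
      change (length b ω (refl γ h') : ℤ) = depth b ω (refl γ h' y) - depth b ω y
      omega

/-- A raising simple reflection gives a covering of the root poset. -/
theorem covBy_of_isStep
    (hP : ∀ (i : ι) (x y : V₀), inner ℝ (P.reflection i x) (P.reflection i y) = inner ℝ x y)
    (hω : IsHighest b ω) {α β : PosRoot b ω} (h : IsStep b ω α.vec β.vec) : α ⋖ β := by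
  have hle : α ≤ β := (posRoot_le_iff hP hω).mpr (Relation.ReflTransGen.single h)
  obtain ⟨hα, γ, hγ, h', hn, e⟩ := h
  have hd := depth_refl_of_form_neg hP hω hγ h' hα (ne_of_form_neg hn) hn
  rw [← e] at hd
  refine ⟨lt_of_le_of_ne hle ?_, fun x h1 h2 => ?_⟩
  · rintro rfl
    omega
  · have := depth_lt_of_lt h1
    have := depth_lt_of_lt h2
    omega

end Depth

/-! ### Steps of constant level, the reversal `α ↦ δ - α`, and short coverings. -/

section Orbits

variable {ι V₀ N : Type*} [NormedAddCommGroup V₀] [InnerProductSpace ℝ V₀]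
  [AddCommGroup N] [Module ℝ N] {P : RootPairing ι ℝ V₀ N} {b : P.Base} {ω : ι}

/-- `x` is a positive root of the finite root system, and `y = s_k(x)` for a simple root `α_k`
with `⟪x, α_k⟫ < 0`. -/
def IsFinStep (b : P.Base) (x y : V₀) : Prop :=
  (∃ i, b.IsPos i ∧ P.root i = x) ∧
    ∃ k ∈ b.support, inner ℝ x (P.root k) < 0 ∧ y = P.reflection k x

/-- A step of the root poset along a simple root of the finite root system. -/
def IsLevelStep (b : P.Base) (v u : Space V₀) : Prop :=
  v ∈ posRoots b ∧
    ∃ k ∈ b.support, inner ℝ v.1 (P.root k) < 0 ∧ u = (P.reflection k v.1, v.2)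

theorem inner_reflection_root
    (hP : ∀ (i : ι) (x y : V₀), inner ℝ (P.reflection i x) (P.reflection i y) = inner ℝ x y)
    (i : ι) (x : V₀) : inner ℝ (P.reflection i x) (P.root i) = -inner ℝ x (P.root i) := by
  rw [← hP i x (P.root i), P.reflection_apply_self, inner_neg_right, neg_neg]

theorem mem_posRoots_level_zero {x : V₀} :
    ((x, 0) : Space V₀) ∈ posRoots b ↔ ∃ i, b.IsPos i ∧ P.root i = x := by
  rw [mem_posRoots_iff]
  constructor
  · rintro ⟨i, n, e, h⟩
    obtain ⟨rfl, e2⟩ := Prod.mk.inj e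
    have hn : n = 0 := by exact_mod_cast e2.symm
    exact ⟨i, h.resolve_left (not_not_intro hn), rfl⟩
  · rintro ⟨i, hi, rfl⟩
    exact ⟨i, 0, by simp, Or.inr hi⟩

theorem mem_posRoots_level_one {x : V₀} :
    ((x, 1) : Space V₀) ∈ posRoots b ↔ ∃ i, P.root i = x := by
  rw [mem_posRoots_iff]
  constructor
  · rintro ⟨i, n, e, -⟩
    exact ⟨i, (Prod.mk.inj e).1.symm⟩
  · rintro ⟨i, rfl⟩
    exact ⟨i, 1, by simp, Or.inl one_ne_zero⟩

/-- A step adds a positive multiple of a simple root, and simple roots have nonnegative level. -/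
theorem IsStep.snd_le {v u : Space V₀} (h : IsStep b ω v u) : v.2 ≤ u.2 := by
  obtain ⟨-, γ, hγ, h', hn, rfl⟩ := h
  have hγγ : 0 < form γ γ := lt_of_le_of_ne real_inner_self_nonneg h'.symm
  have h0 : 0 ≤ γ.2 := by
    obtain ⟨i, n, rfl, -⟩ := mem_posRoots_iff.mp (simpleRoots_subset_posRoots hγ)
    exact n.cast_nonneg
  have h1 : 2 * form v γ / form γ γ ≤ 0 :=
    div_nonpos_of_nonpos_of_nonneg (by linarith) hγγ.le
  rw [refl_apply, Prod.snd_sub, Prod.smul_snd, smul_eq_mul]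
  linarith [mul_nonpos_of_nonpos_of_nonneg h1 h0]

theorem snd_le_of_reflTransGen {v u : Space V₀} (h : Relation.ReflTransGen (IsStep b ω) v u) :
    v.2 ≤ u.2 := by
  induction h with
  | refl => exact le_rfl
  | tail _ hs ih => exact ih.trans hs.snd_le

theorem IsLevelStep.isStep
    (hP : ∀ (i : ι) (x y : V₀), inner ℝ (P.reflection i x) (P.reflection i y) = inner ℝ x y)
    {v u : Space V₀} (h : IsLevelStep b v u) : IsStep b ω v u := by
  obtain ⟨hv, k, hk, hn, rfl⟩ := h
  have hk' := root_mem_simpleRoots (ω := ω) hk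
  exact ⟨hv, _, hk', form_self_ne_zero b ω hk', hn, (refl_root hP k _ v.1 v.2).symm⟩

theorem IsStep.isLevelStep
    (hP : ∀ (i : ι) (x y : V₀), inner ℝ (P.reflection i x) (P.reflection i y) = inner ℝ x y)
    {v u : Space V₀} (h : IsStep b ω v u) (hl : u.2 ≤ v.2) : IsLevelStep b v u := by
  obtain ⟨hv, γ, hγ, h', hn, rfl⟩ := h
  rcases hγ with ⟨k, hk, rfl⟩ | rfl
  · exact ⟨hv, k, hk, hn, refl_root hP k h' v.1 v.2⟩
  · have hγγ : 0 < form (delta - (P.root ω, 0) : Space V₀) (delta - (P.root ω, 0)) :=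
      lt_of_le_of_ne real_inner_self_nonneg h'.symm
    have h1 := div_neg_of_neg_of_pos (mul_neg_of_pos_of_neg two_pos hn) hγγ
    rw [refl_apply, Prod.snd_sub, Prod.smul_snd, smul_eq_mul] at hl
    have h2 : (delta - (P.root ω, 0) : Space V₀).2 = 1 := by simp [delta]
    rw [h2] at hl
    linarith

/-- The level is monotone along a chain, so equal ends force it to be constant. -/
theorem reflTransGen_isLevelStep_iff
    (hP : ∀ (i : ι) (x y : V₀), inner ℝ (P.reflection i x) (P.reflection i y) = inner ℝ x y)
    {v u : Space V₀} (hl : v.2 = u.2) :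
    Relation.ReflTransGen (IsStep b ω) v u ↔ Relation.ReflTransGen (IsLevelStep b) v u := by
  refine ⟨fun h => ?_,
    Relation.ReflTransGen.mono (fun _ _ (h : IsLevelStep b _ _) => h.isStep hP) v u⟩
  induction h using Relation.ReflTransGen.head_induction_on with
  | refl => exact Relation.ReflTransGen.refl
  | head hs ht ih =>
    have h1 := hs.snd_le
    have h2 := snd_le_of_reflTransGen ht
    exact Relation.ReflTransGen.head (hs.isLevelStep hP (h2.trans hl.ge)) (ih (by linarith))

theorem IsFinStep.isLevelStep {x y : V₀} (h : IsFinStep b x y) :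
    IsLevelStep b (x, 0) (y, 0) := by
  obtain ⟨hx, k, hk, hn, rfl⟩ := h
  exact ⟨mem_posRoots_level_zero.mpr hx, k, hk, hn, rfl⟩

/-- The source of the reversal: passing to negatives and exchanging the two ends preserves the
product with `α_k`. -/
theorem IsFinStep.isLevelStep_neg
    (hP : ∀ (i : ι) (x y : V₀), inner ℝ (P.reflection i x) (P.reflection i y) = inner ℝ x y)
    {x y : V₀} (h : IsFinStep b x y) : IsLevelStep b (-y, 1) (-x, 1) := by
  obtain ⟨⟨i, -, rfl⟩, k, hk, hn, rfl⟩ := h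
  refine ⟨mem_posRoots_level_one.mpr ⟨P.reflectionPerm (P.reflectionPerm k i)
    (P.reflectionPerm k i), ?_⟩, k, hk, ?_, ?_⟩
  · rw [root_reflectionPerm_self, P.root_reflectionPerm]
  · rwa [inner_neg_left, inner_reflection_root hP, neg_neg]
  · rw [map_neg, P.reflection_same]

theorem reflTransGen_level_zero {x y : V₀} :
    Relation.ReflTransGen (IsLevelStep b) (x, 0) (y, 0) ↔
      Relation.ReflTransGen (IsFinStep b) x y := by
  refine ⟨fun h => ?_, Relation.ReflTransGen.lift (fun x => ((x, 0) : Space V₀))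
    (fun _ _ (h : IsFinStep b _ _) => h.isLevelStep) x y⟩
  suffices ∀ v : Space V₀, Relation.ReflTransGen (IsLevelStep b) v (y, 0) → v.2 = 0 →
      Relation.ReflTransGen (IsFinStep b) v.1 y from this _ h rfl
  intro v h
  induction h using Relation.ReflTransGen.head_induction_on with
  | refl => exact fun _ => Relation.ReflTransGen.refl
  | @head v u hs _ ih =>
    intro hv
    obtain ⟨hv', k, hk, hn, rfl⟩ := hs
    have e : v = (v.1, 0) := Prod.ext rfl hv
    rw [e, mem_posRoots_level_zero] at hv'
    exact Relation.ReflTransGen.head ⟨hv', k, hk, hn, rfl⟩ (ih hv)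

theorem IsFinStep.ne {x y : V₀}
    (hP : ∀ (i : ι) (x y : V₀), inner ℝ (P.reflection i x) (P.reflection i y) = inner ℝ x y)
    (h : IsFinStep b x y) : x ≠ y := by
  obtain ⟨-, k, -, hn, rfl⟩ := h
  intro e
  have := inner_reflection_root hP k x
  rw [← e] at this
  linarith

theorem delta_sub_eq {V₀ : Type*} [NormedAddCommGroup V₀] (x : V₀) :
    delta - ((x, 0) : Space V₀) = (-x, 1) := by
  simp [delta]

/-- The map `α ↦ δ - α` from `O⁺` to `δ - O⁺`. -/
noncomputable def lowerEquivUpper (b : P.Base) (ω : ι) (O : Set V₀) :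
    lower b ω O ≃ upper b ω O where
  toFun α := ⟨⟨delta - α.1.vec, by
      obtain ⟨x, ⟨-, i, hi, rfl⟩, hα⟩ := α.2
      exact ⟨i, hi, 0, Or.inr (by simp [hα])⟩⟩, by
      obtain ⟨x, hx, hα⟩ := α.2
      exact ⟨x, hx, congrArg (delta - ·) hα⟩⟩
  invFun β := ⟨⟨delta - β.1.vec, by
      obtain ⟨x, ⟨-, i, hi, rfl⟩, hβ⟩ := β.2
      exact ⟨i, hi, 0, Or.inl (by simp [hβ])⟩⟩, by
      obtain ⟨x, hx, hβ⟩ := β.2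
      exact ⟨x, hx, (congrArg (delta - ·) hβ).trans (sub_sub_cancel _ _)⟩⟩
  left_inv α := Subtype.ext (Subtype.ext (sub_sub_cancel _ _))
  right_inv β := Subtype.ext (Subtype.ext (sub_sub_cancel _ _))

theorem lowerEquivUpper_vec {O : Set V₀} (α : lower b ω O) :
    (lowerEquivUpper b ω O α).1.vec = delta - α.1.vec := rfl

/-- A simple root is not antiparallel to a positive root that stays positive. -/
theorem neg_norm_mul_norm_lt_inner [P.IsRootSystem] {x : V₀} {k : ι}
    (hx : ∃ i, b.IsPos i ∧ P.root i = x) (hy : ∃ i, b.IsPos i ∧ P.root i = P.reflection k x) :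
    -(‖x‖ * ‖P.root k‖) < inner ℝ x (P.root k) := by
  -- Equality in the Cauchy-Schwarz inequality makes `x` a multiple of `α_k`, hence `s_k(x) = -x`,
  -- of negative height.
  refine lt_of_le_of_ne (neg_le_of_abs_le (abs_real_inner_le_norm _ _)) fun e => ?_
  have h1 : inner ℝ (-x) (P.root k) = ‖-x‖ * ‖P.root k‖ := by
    rw [inner_neg_left, norm_neg, ← e, neg_neg]
  rw [inner_eq_norm_mul_iff_real] at h1
  have hk : ‖P.root k‖ ≠ 0 := norm_ne_zero_iff.mpr (P.ne_zero k)
  have h2 : x = (-(‖P.root k‖⁻¹ * ‖-x‖)) • P.root k := by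
    rw [neg_smul, mul_smul, ← h1, smul_neg, smul_neg, neg_neg, smul_smul, inv_mul_cancel₀ hk,
      one_smul]
  have h3 : P.reflection k x = -x := by
    rw [h2, map_smul, P.reflection_apply_self, smul_neg]
  obtain ⟨i, hi, rfl⟩ := hx
  obtain ⟨j, hj, hj'⟩ := hy
  rw [← heightMap_pos_iff] at hi hj
  rw [hj', h3, map_neg] at hj
  linarith

theorem IsFinStep.pos [Finite ι] [P.IsCrystallographic] [P.IsReduced] {x y : V₀}
    (h : IsFinStep b x y) : ∃ i, b.IsPos i ∧ P.root i = y := by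
  obtain ⟨⟨i, hi, rfl⟩, k, hk, hn, rfl⟩ := h
  refine ⟨_, hi.reflectionPerm hk ?_, P.root_reflectionPerm k i⟩
  rintro rfl
  exact absurd hn (not_lt.mpr real_inner_self_nonneg)

theorem pos_of_reflTransGen_isFinStep [Finite ι] [P.IsCrystallographic]
    [P.IsReduced] {x y : V₀} (h : Relation.ReflTransGen (IsFinStep b) x y)
    (hx : ∃ i, b.IsPos i ∧ P.root i = x) : ∃ i, b.IsPos i ∧ P.root i = y := by
  cases h with
  | refl => exact hx
  | tail _ h => exact h.pos

theorem IsFinStep.mem_orbitPos [Finite ι] [P.IsCrystallographic] [P.IsReduced] {O : Set V₀}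
    (hO : ∃ i : ι, O = MulAction.orbit P.weylGroup (P.root i)) {x y : V₀}
    (h : IsFinStep b x y) (hx : x ∈ orbitPos b O) : y ∈ orbitPos b O := by
  refine ⟨?_, h.pos⟩
  obtain ⟨i, rfl⟩ := hO
  obtain ⟨-, k, -, -, rfl⟩ := h
  have := MulAction.mem_orbit_of_mem_orbit (RootPairing.weylGroup.ofIdx P k) hx.1
  rwa [RootPairing.weylGroup.ofIdx_smul] at this

/-- Level one also contains the roots `δ + α`, so a chain might leave `δ - Φ₀⁺`. Reading it
backwards from `δ - y` rules this out: finite steps from the positive root `y` remain positive. -/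
theorem reflTransGen_level_one [Finite ι] [P.IsCrystallographic] [P.IsReduced]
    (hP : ∀ (i : ι) (x y : V₀), inner ℝ (P.reflection i x) (P.reflection i y) = inner ℝ x y)
    {x y : V₀} (hy : ∃ i, b.IsPos i ∧ P.root i = y) :
    Relation.ReflTransGen (IsLevelStep b) (-x, 1) (-y, 1) ↔
      Relation.ReflTransGen (IsFinStep b) y x := by
  constructor
  · intro h
    suffices ∀ v : Space V₀, Relation.ReflTransGen (IsLevelStep b) v (-y, 1) →
        Relation.ReflTransGen (IsFinStep b) y (-v.1) by simpa using this _ h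
    intro v h
    induction h using Relation.ReflTransGen.head_induction_on with
    | refl => simpa using Relation.ReflTransGen.refl
    | @head v u hs _ ih =>
      obtain ⟨-, k, hk, hn, rfl⟩ := hs
      refine ih.tail ⟨pos_of_reflTransGen_isFinStep ih hy, k, hk, ?_, ?_⟩
      · rwa [inner_neg_left, inner_reflection_root hP, neg_neg]
      · rw [map_neg, P.reflection_same]
  · intro h
    exact Relation.ReflTransGen.lift (r := Function.swap (IsFinStep b))
      (fun x => ((-x, 1) : Space V₀)) (fun _ _ h => IsFinStep.isLevelStep_neg hP h) x y
      (Relation.ReflTransGen.swap x y h)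

variable [P.IsRootSystem] [Finite ι] [P.IsCrystallographic] [P.IsReduced]

/-- The lower part of the root poset is the poset generated by the raising simple reflections of
the finite root system. -/
theorem le_iff_of_vec_eq
    (hP : ∀ (i : ι) (x y : V₀), inner ℝ (P.reflection i x) (P.reflection i y) = inner ℝ x y)
    (hω : IsHighest b ω) {α β : PosRoot b ω} {x y : V₀} (hα : α.vec = (x, 0))
    (hβ : β.vec = (y, 0)) : α ≤ β ↔ Relation.ReflTransGen (IsFinStep b) x y := by
  rw [posRoot_le_iff hP hω, hα, hβ]
  exact (reflTransGen_isLevelStep_iff (v := (x, 0)) (u := (y, 0)) hP rfl).trans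
    reflTransGen_level_zero

theorem le_iff_of_vec_eq_delta_sub
    (hP : ∀ (i : ι) (x y : V₀), inner ℝ (P.reflection i x) (P.reflection i y) = inner ℝ x y)
    (hω : IsHighest b ω) {α β : PosRoot b ω} {x y : V₀} (hα : α.vec = delta - (x, 0))
    (hβ : β.vec = delta - (y, 0)) (hy : ∃ i, b.IsPos i ∧ P.root i = y) :
    α ≤ β ↔ Relation.ReflTransGen (IsFinStep b) y x := by
  rw [posRoot_le_iff hP hω, hα, hβ, delta_sub_eq, delta_sub_eq]
  exact (reflTransGen_isLevelStep_iff (v := (-x, 1)) (u := (-y, 1)) hP rfl).trans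
    (reflTransGen_level_one hP hy)

theorem isShortCovering_of_isLevelStep
    (hP : ∀ (i : ι) (x y : V₀), inner ℝ (P.reflection i x) (P.reflection i y) = inner ℝ x y)
    (hω : IsHighest b ω) {α β : PosRoot b ω} {k : ι} (hk : k ∈ b.support)
    (hn : inner ℝ α.vec.1 (P.root k) < 0)
    (hs : -(‖α.vec.1‖ * ‖P.root k‖) < inner ℝ α.vec.1 (P.root k))
    (hβ : β.vec = (P.reflection k α.vec.1, α.vec.2)) : IsShortCovering α β := by
  have hk' := root_mem_simpleRoots (ω := ω) hk
  have h' := form_self_ne_zero b ω hk'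
  have hstep : IsLevelStep b α.vec β.vec := ⟨α.2, k, hk, hn, hβ⟩
  refine ⟨covBy_of_isStep hP hω (hstep.isStep hP), _, hk', h', ?_, ?_, ?_, hn⟩
  · exact ne_of_form_neg hn
  · rw [hβ]
    exact refl_root hP k h' _ _
  · rw [affNorm_eq, affNorm_eq]
    exact hs

theorem IsFinStep.isShortCovering
    (hP : ∀ (i : ι) (x y : V₀), inner ℝ (P.reflection i x) (P.reflection i y) = inner ℝ x y)
    (hω : IsHighest b ω) {α β : PosRoot b ω} {x y : V₀} (h : IsFinStep b x y)
    (hα : α.vec = (x, 0)) (hβ : β.vec = (y, 0)) : IsShortCovering α β := by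
  have hy := h.pos
  obtain ⟨hx, k, hk, hn, rfl⟩ := h
  refine isShortCovering_of_isLevelStep hP hω hk ?_ ?_ ?_ <;> rw [hα]
  · exact hn
  · exact neg_norm_mul_norm_lt_inner hx hy
  · exact hβ

/-- The strict bound for `x` transfers to `-s_k(x)`, which has the same norm and the same product
with `α_k`. -/
theorem IsFinStep.isShortCovering_delta_sub
    (hP : ∀ (i : ι) (x y : V₀), inner ℝ (P.reflection i x) (P.reflection i y) = inner ℝ x y)
    (hω : IsHighest b ω) {α β : PosRoot b ω} {x y : V₀} (h : IsFinStep b x y)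
    (hα : α.vec = delta - (y, 0)) (hβ : β.vec = delta - (x, 0)) : IsShortCovering α β := by
  obtain ⟨hx, k, hk, hn, rfl⟩ := h
  have h1 : inner ℝ (-P.reflection k x) (P.root k) = inner ℝ x (P.root k) := by
    rw [inner_neg_left, inner_reflection_root hP, neg_neg]
  have h2 : ‖P.reflection k x‖ = ‖x‖ := by
    rw [norm_eq_sqrt_real_inner, hP, ← norm_eq_sqrt_real_inner]
  have hy := IsFinStep.pos ⟨hx, k, hk, hn, rfl⟩
  rw [delta_sub_eq] at hα hβ
  refine isShortCovering_of_isLevelStep hP hω hk ?_ ?_ ?_ <;> rw [hα]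
  · exact h1 ▸ hn
  · rw [h1, norm_neg, h2]
    exact neg_norm_mul_norm_lt_inner hx hy
  · rw [hβ, map_neg, P.reflection_same]

theorem isShortCovering_of_covBy_lower
    (hP : ∀ (i : ι) (x y : V₀), inner ℝ (P.reflection i x) (P.reflection i y) = inner ℝ x y)
    (hω : IsHighest b ω) {O : Set V₀} (hO : ∃ i : ι, O = MulAction.orbit P.weylGroup (P.root i))
    {α β : lower b ω O} (h : α ⋖ β) : IsShortCovering α.1 β.1 := by
  obtain ⟨x, hx, hα⟩ := α.2
  obtain ⟨y, hy, hβ⟩ := β.2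
  have hle : α.1 ≤ β.1 := h.le
  rw [le_iff_of_vec_eq hP hω hα hβ] at hle
  rcases Relation.ReflTransGen.cases_head hle with rfl | ⟨z, hxz, hzy⟩
  · exact absurd (Subtype.ext (Subtype.ext (hα.trans hβ.symm))) h.ne
  · obtain ⟨ζ, hζ, hζz⟩ := exists_mem_lower b ω O (hxz.mem_orbitPos hO hx)
    have h1 : α ≤ ⟨ζ, hζ⟩ :=
      (le_iff_of_vec_eq hP hω hα hζz).mpr (Relation.ReflTransGen.single hxz)
    have h2 : (⟨ζ, hζ⟩ : lower b ω O) ≤ β := (le_iff_of_vec_eq hP hω hζz hβ).mpr hzy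
    rcases h.eq_or_eq h1 h2 with e | e
    · refine absurd ?_ (hxz.ne hP)
      have := congrArg (fun ξ : lower b ω O => ξ.1.vec.1) e
      simpa [hα, hζz] using this.symm
    · rw [← e]
      exact hxz.isShortCovering hP hω hα hζz

theorem isShortCovering_of_covBy_upper
    (hP : ∀ (i : ι) (x y : V₀), inner ℝ (P.reflection i x) (P.reflection i y) = inner ℝ x y)
    (hω : IsHighest b ω) {O : Set V₀} (hO : ∃ i : ι, O = MulAction.orbit P.weylGroup (P.root i))
    {α β : upper b ω O} (h : α ⋖ β) : IsShortCovering α.1 β.1 := by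
  obtain ⟨x, hx, hα⟩ := α.2
  obtain ⟨y, hy, hβ⟩ := β.2
  have hle : α.1 ≤ β.1 := h.le
  rw [le_iff_of_vec_eq_delta_sub hP hω hα hβ hy.2] at hle
  rcases Relation.ReflTransGen.cases_head hle with rfl | ⟨z, hyz, hzx⟩
  · exact absurd (Subtype.ext (Subtype.ext (hα.trans hβ.symm))) h.ne
  · have hz := hyz.mem_orbitPos hO hy
    -- The order is reversed here: the first finite step from `y` is the last step of the chain up
    -- to `β`.
    obtain ⟨ζ, hζ, hζz⟩ := exists_mem_upper b ω O hz
    have h1 : α ≤ ⟨ζ, hζ⟩ := (le_iff_of_vec_eq_delta_sub hP hω hα hζz hz.2).mpr hzx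
    have h2 : (⟨ζ, hζ⟩ : upper b ω O) ≤ β :=
      (le_iff_of_vec_eq_delta_sub hP hω hζz hβ hy.2).mpr (Relation.ReflTransGen.single hyz)
    rcases h.eq_or_eq h1 h2 with e | e
    · rw [← e]
      exact hyz.isShortCovering_delta_sub hP hω hζz hβ
    · refine absurd ?_ (hyz.ne hP)
      have := congrArg (fun ξ : upper b ω O => ξ.1.vec.1) e
      simpa [hβ, hζz, delta] using this.symm

theorem lowerEquivUpper_le_iff
    (hP : ∀ (i : ι) (x y : V₀), inner ℝ (P.reflection i x) (P.reflection i y) = inner ℝ x y)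
    (hω : IsHighest b ω) {O : Set V₀} (α β : lower b ω O) :
    lowerEquivUpper b ω O β ≤ lowerEquivUpper b ω O α ↔ α ≤ β := by
  obtain ⟨x, hx, hα⟩ := α.2
  obtain ⟨y, hy, hβ⟩ := β.2
  rw [← Subtype.coe_le_coe, ← Subtype.coe_le_coe, le_iff_of_vec_eq hP hω hα hβ]
  refine le_iff_of_vec_eq_delta_sub hP hω ?_ ?_ hx.2
  · rw [lowerEquivUpper_vec, hβ]
  · rw [lowerEquivUpper_vec, hα]

end Orbits

end AffineRoots

theorem mainTheorem4 {ι V₀ N : Type*} [Finite ι]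
    [NormedAddCommGroup V₀] [InnerProductSpace ℝ V₀] [AddCommGroup N] [Module ℝ N]
    (P : RootPairing ι ℝ V₀ N) [P.IsRootSystem] [P.IsCrystallographic] [P.IsReduced]
    [P.IsIrreducible]
    (hP : ∀ (i : ι) (x y : V₀), inner ℝ (P.reflection i x) (P.reflection i y) = inner ℝ x y)
    (b : P.Base) (ω : ι) (hω : AffineRoots.IsHighest b ω)
    (O : Set V₀) (hO : ∃ i : ι, O = MulAction.orbit P.weylGroup (P.root i)) :
    (∃ φ : AffineRoots.lower b ω O ≃o (AffineRoots.upper b ω O)ᵒᵈ,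
      ∀ α : AffineRoots.lower b ω O,
        (OrderDual.ofDual (φ α)).1.vec = AffineRoots.delta - α.1.vec) ∧
    (∀ α β : AffineRoots.lower b ω O, α ⋖ β → AffineRoots.IsShortCovering α.1 β.1) ∧
    (∀ α β : AffineRoots.upper b ω O, α ⋖ β → AffineRoots.IsShortCovering α.1 β.1) := by
  refine ⟨⟨⟨(AffineRoots.lowerEquivUpper b ω O).trans OrderDual.toDual, fun {α β} => ?_⟩,
      fun α => AffineRoots.lowerEquivUpper_vec α⟩,
    fun _ _ h => AffineRoots.isShortCovering_of_covBy_lower hP hω hO h,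
    fun _ _ h => AffineRoots.isShortCovering_of_covBy_upper hP hω hO h⟩
  rw [Equiv.trans_apply, Equiv.trans_apply, OrderDual.toDual_le_toDual]
  exact AffineRoots.lowerEquivUpper_le_iff hP hω α β
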